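/- Strings are finite binary strings and $\ell(x)$ is the length of $x$. Let $U$ be a universal prefix computer: a partial recursive function from strings to strings with prefix-free domain such that for every such function $M$ there is a constant $c_M$ with the property that whenever $M(p)=x$ there is $q$ with $\ell(q)\le \ell(p)+c_M$ and $U(q)=x$. Let $V$ be a reference machine for plain complexity: a two-tape Turing machine (input tape and output tape) that is universal in the same sense with respect to all partial recursive functions on strings, and that can copy $n$ bits from one tape to the other in time $n$ up to a constant (that is, it simulates the machine that copies its input tape bit by bit to the output tape, on inputs with a fixed program prefix prepended, with at most a constant number of additional steps). Put $$C(x):=\min\{\ell(p)\mid V(p)=x\},\qquad K(x):=\min\{\ell(p)\mid U(p)=x\},$$ let $K(n)$, for $n\in\mathbb N=\{0,1,2,\ldots\}$, be $K$ of the $n$-th string in length-lexicographic order, and for $z\in\mathbb N$ put $${\rm Depth}_z(x):=\min\{T(p)\mid \ell(p)-C(x)\le z,\ V(p)=x\},$$ where $T(p)$ is the halting time (number of steps) of $V$ on input $p$. For $r,m,k\in\mathbb N$, a string $x$ is called $r$-incompressible if $K(x)\ge \ell(x)+K(\ell(x))-r$, $m$-random if $C(x)\ge\ell(x)-m$, and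 $k$-well-behaved if $K(x)+k\ge C(x)+K(C(x))$. **Lemma (Incompressible and Shallow Strings).** There are constants $c,\beta,\gamma\in\mathbb N$ and a function $k:\mathbb N\times\mathbb N\to\mathbb N$, depending only on $U$ and $V$, such that for all $r,m\in\mathbb N$: 1. for every $n\in\mathbb N$ there are at least $2^n(1-2^{-r+c}-2^{-m})$ strings of length $n$ that are both $r$-incompressible and $m$-random; 2. every string $x$ that is both $r$-incompressible and $m$-random satisfies ${\rm Depth}_{m+\beta}(x)\le \ell(x)+\gamma$ and is $k(r,m)$-well-behaved. -/

import Mathlib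

namespace AlgInfo

/-! ### Two-tape Turing machines with a step count -/

/-- A deterministic two-tape Turing machine: a finite tape alphabet with a blank and two distinct
nonblank symbols representing the bits `0` and `1`, a finite set of states, an initial state, and a
transition function. In one step the machine reads the two scanned symbols, changes its state, and
on each tape writes a symbol and moves the head by one cell (`some .left` or `some .right`)
or leaves it in place (`none`). The machine halts where the transition function is undefined. -/
structure TwoTapeTM where
  Sym : Type
  State : Type
  [finiteSym : Finite Sym]
  [finiteState : Finite State]
  blank : Sym
  bit : Bool → Sym
  bit_injective : Function.Injective bit
  bit_ne_blank : ∀ b, bit b ≠ blank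
  start : State
  trans : State → Sym → Sym →
    Option (State × (Sym × Option Turing.Dir) × (Sym × Option Turing.Dir))

/-- A two-way infinite tape with a head. -/
structure HeadedTape (Γ : Type) where
  cell : ℤ → Γ
  head : ℤ

/-- Write a symbol in the scanned cell, then move the head (or not). -/
def HeadedTape.act {Γ : Type} (T : HeadedTape Γ) (a : Γ × Option Turing.Dir) : HeadedTape Γ where
  cell := Function.update T.cell T.head a.1
  head := match a.2 with
    | none => T.head
    | some .left => T.head - 1
    | some .right => T.head + 1

namespace TwoTapeTM

/-- Configurations: the state and the two tapes. The first tape is the input tape, the second one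
is the output tape. -/
structure Cfg (M : TwoTapeTM) where
  state : M.State
  inTape : HeadedTape M.Sym
  outTape : HeadedTape M.Sym

/-- One computation step; `none` if the machine has halted. -/
def step (M : TwoTapeTM) (c : M.Cfg) : Option M.Cfg :=
  (M.trans c.state (c.inTape.cell c.inTape.head) (c.outTape.cell c.outTape.head)).map
    fun a => ⟨a.1, c.inTape.act a.2.1, c.outTape.act a.2.2⟩

/-- The initial configuration on input `p`: the bits of `p` stand in the cells
`0, …, ℓ(p) - 1` of the input tape, all other cells are blank, both heads scan cell `0`. -/
def init (M : TwoTapeTM) (p : List Bool) : M.Cfg where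
  state := M.start
  inTape :=
    { cell := fun i => if 0 ≤ i then (p[i.toNat]?).elim M.blank M.bit else M.blank
      head := 0 }
  outTape := { cell := fun _ => M.blank, head := 0 }

/-- The output of a configuration is the maximal bit string on the output tape that starts in
cell `0`. -/
def Cfg.Outputs {M : TwoTapeTM} (c : M.Cfg) (y : List Bool) : Prop :=
  (∀ (i : ℕ) (b : Bool), y[i]? = some b → c.outTape.cell i = M.bit b) ∧
    ∀ b : Bool, c.outTape.cell y.length ≠ M.bit b

/-- On input `p`, the machine `M` halts after exactly `t` steps, with output `y`; that is,
`M(p) = y` and the halting time of `M` on `p` is `t`. -/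
def HaltsWith (M : TwoTapeTM) (p y : List Bool) (t : ℕ) : Prop :=
  ∃ c : M.Cfg, (fun o : Option M.Cfg => o.bind M.step)^[t] (some (M.init p)) = some c ∧
    M.step c = none ∧ c.Outputs y

/-- `M(p) = y`. -/
def Computes (M : TwoTapeTM) (p y : List Bool) : Prop := ∃ t, M.HaltsWith p y t

/-- `V` is universal (in the sense of additive optimality): each description of a string with
respect to a partial recursive function `f` can be replaced by a `V`-program that is longer by at
most a constant depending only on `f`. -/
def IsUniversal (V : TwoTapeTM) : Prop :=
  ∀ f : List Bool →. List Bool, Partrec f →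
    ∃ c : ℕ, ∀ p x, x ∈ f p → ∃ q, q.length ≤ p.length + c ∧ V.Computes q x

/-- The machine that copies the input tape to the output tape, one bit per step, and halts at the
first blank cell. -/
def copier : TwoTapeTM where
  Sym := Option Bool
  State := Unit
  blank := none
  bit := some
  bit_injective := Option.some_injective Bool
  bit_ne_blank := fun _ => Option.some_ne_none _
  start := ()
  trans := fun _ a _ => match a with
    | none => none
    | some b => some ((), (some b, some .right), (some b, some .right))

/-- `V` simulates `M` with constant delay: for some fixed program `q` and some constant `d`, on the
input `q` followed by `x` it does what `M` does on `x`, in at most `d` additional steps. -/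
def SimulatesWithConstantDelay (V M : TwoTapeTM) : Prop :=
  ∃ (q : List Bool) (d : ℕ), ∀ (x y : List Bool) (t : ℕ),
    M.HaltsWith x y t → ∃ t' ≤ t + d, V.HaltsWith (q ++ x) y t'

/-- The reference machines that are admitted for the definition of logical depth: universal
two-tape machines that can copy `n` bits from one tape to the other in time `n` (up to a constant
for initialization). -/
structure IsReference (V : TwoTapeTM) : Prop where
  universal : V.IsUniversal
  copies : V.SimulatesWithConstantDelay copier

end TwoTapeTM

/-! ### Prefix computers -/

/-- A prefix computer: a partial recursive function on strings such that if it is defined at `s`,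
it is undefined at every proper extension of `s`. -/
structure IsPrefixComputer (U : List Bool →. List Bool) : Prop where
  partrec : Partrec U
  prefix_free : ∀ s t : List Bool, t ≠ [] → (U s).Dom → ¬ (U (s ++ t)).Dom

/-- A universal prefix computer (in the sense of additive optimality). -/
structure IsUniversalPrefixComputer (U : List Bool →. List Bool) : Prop
    extends IsPrefixComputer U where
  universal : ∀ M : List Bool →. List Bool, IsPrefixComputer M →
    ∃ c : ℕ, ∀ p x, x ∈ M p → ∃ q, q.length ≤ p.length + c ∧ x ∈ U q

/-! ### Complexities, randomness, depth -/

/-- Plain Kolmogorov complexity `C(x)`. (The set is nonempty if `V` is universal.) -/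
noncomputable def plainK (V : TwoTapeTM) (x : List Bool) : ℕ :=
  sInf {l | ∃ p : List Bool, p.length = l ∧ V.Computes p x}

/-- Prefix Kolmogorov complexity `K(x)`. (The set is nonempty if `U` is universal.) -/
noncomputable def prefixK (U : List Bool →. List Bool) (x : List Bool) : ℕ :=
  sInf {l | ∃ p : List Bool, p.length = l ∧ x ∈ U p}

/-- The standard identification of natural numbers with binary strings in length-lexicographic
order, `0 ↦ λ, 1 ↦ 0, 2 ↦ 1, 3 ↦ 00, 4 ↦ 01, …`: the binary expansion of `n + 1` without its
leading digit. -/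
def natString (n : ℕ) : List Bool := (n + 1).bits.dropLast.reverse

/-- Prefix Kolmogorov complexity `K(n)` of a natural number. -/
noncomputable def prefixKNat (U : List Bool →. List Bool) (n : ℕ) : ℕ := prefixK U (natString n)

/-- `x` is `r`-incompressible: `K(x) ≥ ℓ(x) + K(ℓ(x)) - r`. -/
def IsIncompressible (U : List Bool →. List Bool) (r : ℕ) (x : List Bool) : Prop :=
  x.length + prefixKNat U x.length ≤ prefixK U x + r

/-- `x` is `m`-random: `C(x) ≥ ℓ(x) - m`. -/
def IsRandom (V : TwoTapeTM) (m : ℕ) (x : List Bool) : Prop :=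
  x.length ≤ plainK V x + m

/-- `x` is `k`-well-behaved: `K(x) + k ≥ C(x) + K(C(x))`. -/
def IsWellBehaved (U : List Bool →. List Bool) (V : TwoTapeTM) (k : ℕ) (x : List Bool) : Prop :=
  plainK V x + prefixKNat U (plainK V x) ≤ prefixK U x + k

/-- Logical depth at significance level `z`: the least halting time of a program for `x` whose
length exceeds `C(x)` by at most `z`. (Such programs exist if `V` is universal.) -/
noncomputable def depth (V : TwoTapeTM) (z : ℕ) (x : List Bool) : ℕ :=
  sInf {t | ∃ p : List Bool, p.length ≤ plainK V x + z ∧ V.HaltsWith p x t}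

end AlgInfo

namespace AlgInfo

/-! ### Determinism of two-tape machines and the run of the copier -/

namespace TwoTapeTM

variable {M : TwoTapeTM}

/-! Counting is a union bound on the complement. A string of length `n` that is not `m`-random has a
program shorter than `n - m`, so there are at most `2^(n-m)` of them. If `x` is not
`r`-incompressible, then `2^(-K(x)) > 2^(r-n-K(n))`. Composing `U` with the length function gives a
prefix computer for which shortest programs of strings of length `n` are all programs for `n`; by
the coding theorem their total weight is at most `2^(c-K(n))`, so there are at most `2^(n-r+c)` such
`x` (`exists_card_not_isIncompressible_le`).

The coding theorem rests on Kraft's inequality and its effective converse. While programs for `y`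
are enumerated, a request for length `L + 1` is issued once the weight found reaches `2^(-L)`. These
requests form a geometric series bounded by the probability of `y`, so their total weight is at most
1. Consecutive subintervals of the unit interval then serve them by a prefix-free set of programs.

For the second item, the copying program has length `ℓ(x) + O(1) ≤ C(x) + m + O(1)` and runs in time
`ℓ(x) + O(1)`. Moreover `C(x)` and `ℓ(x)` differ by a bounded amount, hence so do `K(C(x))` and
`K(ℓ(x))`, and incompressibility turns into well-behavedness. -/

theorem iterate_bind_none {α : Type*} (f : α → Option α) (k : ℕ) :
    (fun o : Option α => o.bind f)^[k] none = none :=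
  Function.iterate_fixed rfl k

theorem HaltsWith.time_le {p y y' : List Bool} {t t' : ℕ} (h : M.HaltsWith p y t)
    (h' : M.HaltsWith p y' t') : t' ≤ t := by
  obtain ⟨c, hc, hs, -⟩ := h
  obtain ⟨c', hc', -, -⟩ := h'
  by_contra! hlt
  obtain ⟨k, rfl⟩ := Nat.exists_eq_add_of_lt hlt
  rw [show t + k + 1 = k + (t + 1) by omega, Function.iterate_add_apply,
    Function.iterate_succ_apply', hc, Option.bind_some, hs, iterate_bind_none] at hc'
  cases hc'

theorem Cfg.Outputs.unique {c : M.Cfg} {y y' : List Bool} (h : c.Outputs y) (h' : c.Outputs y') :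
    y = y' := by
  -- If `v` were shorter than `u`, cell `v.length` would hold a bit of `u`, against the maximality
  -- of `v`.
  have key : ∀ {u v : List Bool}, c.Outputs u → c.Outputs v → u.length ≤ v.length := by
    intro u v hu hv
    by_contra! hlt
    exact hv.2 _ (hu.1 v.length u[v.length] (List.getElem?_eq_getElem hlt))
  have hlen := le_antisymm (key h h') (key h' h)
  refine List.ext_getElem hlen fun i h₁ h₂ => M.bit_injective ?_
  rw [← h.1 i _ (List.getElem?_eq_getElem h₁), ← h'.1 i _ (List.getElem?_eq_getElem h₂)]

theorem Computes.unique {p y y' : List Bool} (h : M.Computes p y) (h' : M.Computes p y') :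
    y = y' := by
  obtain ⟨t, h⟩ := h
  obtain ⟨t', h'⟩ := h'
  obtain rfl := le_antisymm (h'.time_le h) (h.time_le h')
  obtain ⟨c, hc, -, ho⟩ := h
  obtain ⟨c', hc', -, ho'⟩ := h'
  obtain rfl : c = c' := Option.some.inj (hc.symm.trans hc')
  exact ho.unique ho'

/-- The configuration of `copier` on input `x` after `i` steps. -/
def copierCfg (x : List Bool) (i : ℕ) : copier.Cfg where
  state := ()
  inTape := { cell := (copier.init x).inTape.cell, head := i }
  outTape :=
    { cell := fun j => if j < i then (copier.init x).inTape.cell j else none, head := i }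

theorem copier_init_cell (x : List Bool) (i : ℕ) :
    (copier.init x).inTape.cell i = x[i]? := by
  cases h : x[i]? <;> simp [init, h, copier]

theorem copier_init_cell_neg (x : List Bool) {j : ℤ} (hj : j < 0) :
    (copier.init x).inTape.cell j = none := by
  simp [init, copier, not_le.2 hj]

theorem copier_step_of_lt (x : List Bool) {i : ℕ} (hi : i < x.length) :
    copier.step (copierCfg x i) = some (copierCfg x (i + 1)) := by
  have hc : (copierCfg x i).inTape.cell (copierCfg x i).inTape.head = some x[i] := by
    simp only [copierCfg]
    rw [copier_init_cell, List.getElem?_eq_getElem hi]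
  have hc' : (copier.init x).inTape.cell i = copier.bit x[i] := hc
  have hin : Function.update (copierCfg x i).inTape.cell i (copier.bit x[i]) =
      (copierCfg x (i + 1)).inTape.cell := by
    rw [← hc']
    exact Function.update_eq_self _ _
  have hout : Function.update (copierCfg x i).outTape.cell i (copier.bit x[i]) =
      (copierCfg x (i + 1)).outTape.cell := by
    funext j
    by_cases hj : j = (i : ℤ)
    · subst hj
      rw [Function.update_self]
      simpa [copierCfg] using hc'.symm
    · rw [Function.update_of_ne hj]
      have : j < (i : ℤ) ↔ j < ((i + 1 : ℕ) : ℤ) := by push_cast; omega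
      simp only [copierCfg, this]
  unfold step
  rw [hc]
  change some (Cfg.mk (M := copier) () ⟨Function.update (copierCfg x i).inTape.cell i (copier.bit x[i]), _⟩
    ⟨Function.update (copierCfg x i).outTape.cell i (copier.bit x[i]), _⟩) = _
  rw [hin, hout]
  rfl

theorem copier_iterate (x : List Bool) {i : ℕ} (hi : i ≤ x.length) :
    (fun o : Option copier.Cfg => o.bind copier.step)^[i] (some (copier.init x)) =
      some (copierCfg x i) := by
  induction i with
  | zero =>
    have hout : (copierCfg x 0).outTape.cell = (copier.init x).outTape.cell := by
      funext j
      by_cases hj : j < 0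
      · simp only [copierCfg, Nat.cast_zero, hj]
        exact copier_init_cell_neg x hj
      · simp only [copierCfg, Nat.cast_zero, hj]
        rfl
    change _ = some (Cfg.mk (M := copier) () _ ⟨(copierCfg x 0).outTape.cell, _⟩)
    rw [hout]
    rfl
  | succ i ih =>
    rw [Function.iterate_succ_apply', ih (by omega), Option.bind_some, copier_step_of_lt x (by omega)]

theorem copier_haltsWith (x : List Bool) : copier.HaltsWith x x x.length := by
  refine ⟨_, copier_iterate x le_rfl, ?_, ?_, ?_⟩
  · have hc : (copierCfg x x.length).inTape.cell (copierCfg x x.length).inTape.head = none := by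
      simp only [copierCfg]
      rw [copier_init_cell, List.getElem?_eq_none le_rfl]
    unfold step
    rw [hc]; rfl
  · intro i b hb
    have hi : i < x.length := by
      by_contra! h
      rw [List.getElem?_eq_none h] at hb; cases hb
    simp only [copierCfg, Nat.cast_lt, hi]
    rw [copier_init_cell, hb]; rfl
  · intro b
    simp [copierCfg, copier]

end TwoTapeTM
-- Binary values and the length-lexicographic numbering
/-- The natural number with binary expansion `s` (most significant bit first). -/
def binVal (s : List Bool) : ℕ := s.foldl (fun a b => 2 * a + b.toNat) 0

@[simp] theorem binVal_nil : binVal [] = 0 := rfl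

theorem binVal_concat (s : List Bool) (b : Bool) :
    binVal (s ++ [b]) = 2 * binVal s + b.toNat := by
  simp [binVal]

theorem binVal_append (s u : List Bool) :
    binVal (s ++ u) = binVal s * 2 ^ u.length + binVal u := by
  induction u using List.reverseRecOn with
  | nil => simp
  | append_singleton u b ih =>
    rw [← List.append_assoc, binVal_concat, ih, binVal_concat, List.length_append,
      List.length_singleton, pow_succ]
    ring

theorem binVal_lt (s : List Bool) : binVal s < 2 ^ s.length := by
  induction s using List.reverseRecOn with
  | nil => simp
  | append_singleton u b ih =>
    rw [binVal_concat, List.length_append, List.length_singleton, pow_succ]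
    have := b.toNat_le
    omega

theorem exists_binVal_eq {L v : ℕ} (hv : v < 2 ^ L) :
    ∃ s : List Bool, s.length = L ∧ binVal s = v := by
  induction L generalizing v with
  | zero => exact ⟨[], rfl, by rw [pow_zero] at hv; simp; omega⟩
  | succ L ih =>
    obtain ⟨s, hs, hv'⟩ := ih (v := v / 2) (by rw [pow_succ] at hv; omega)
    refine ⟨s ++ [decide (v % 2 = 1)], by simp [hs], ?_⟩
    rw [binVal_concat, hv']
    rcases Nat.mod_two_eq_zero_or_one v with h | h <;> simp [h] <;> omega

theorem primrec_binVal : Primrec binVal :=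
  Primrec.list_foldl Primrec.id (Primrec.const 0)
    (Primrec₂.mk (f := fun (_ : List Bool) (x : ℕ × Bool) => 2 * x.1 + x.2.toNat) (Primrec.nat_add.comp
      (Primrec.nat_mul.comp (Primrec.const 2) (Primrec.fst.comp Primrec.snd))
      ((Primrec.dom_finite Bool.toNat).comp (Primrec.snd.comp Primrec.snd))))

theorem primrec₂_pow : Primrec₂ ((· ^ ·) : ℕ → ℕ → ℕ) :=
  Primrec₂.unpaired'.1 Nat.Primrec.pow

/-- The position of a string in length-lexicographic order. -/
def natOfString (s : List Bool) : ℕ := binVal s + 2 ^ s.length - 1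

/-- The right-hand side is the value of `s` with a leading digit 1, the expansion that `natString`
strips. -/
theorem natOfString_add_one (s : List Bool) : natOfString s + 1 = binVal s + 2 ^ s.length := by
  have := Nat.two_pow_pos s.length
  unfold natOfString
  omega

theorem natString_natOfString (s : List Bool) : natString (natOfString s) = s := by
  suffices h : (natOfString s + 1).bits = s.reverse ++ [true] by simp [natString, h]
  rw [natOfString_add_one]
  induction s using List.reverseRecOn with
  | nil => simp
  | append_singleton u b ih =>
    have hbit : binVal (u ++ [b]) + 2 ^ (u ++ [b]).length =
        Nat.bit b (binVal u + 2 ^ u.length) := by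
      rw [binVal_concat, List.length_append, List.length_singleton, pow_succ, Nat.bit_val]
      ring
    have hpos := Nat.two_pow_pos u.length
    rw [hbit, Nat.bits_append_bit _ _ (fun h => by omega), ih]
    simp

theorem natOfString_surjective : Function.Surjective natOfString := by
  intro n
  have h1 : 2 ^ Nat.log 2 (n + 1) ≤ n + 1 := Nat.pow_log_le_self 2 (by omega)
  have h2 : n + 1 < 2 ^ (Nat.log 2 (n + 1) + 1) := Nat.lt_pow_succ_log_self (by norm_num) _
  obtain ⟨s, hs, hv⟩ := exists_binVal_eq (L := Nat.log 2 (n + 1))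
    (v := n + 1 - 2 ^ Nat.log 2 (n + 1)) (by rw [pow_succ] at h2; omega)
  refine ⟨s, ?_⟩
  have := natOfString_add_one s
  rw [hs, hv] at this
  omega

theorem natOfString_natString (n : ℕ) : natOfString (natString n) = n := by
  obtain ⟨s, rfl⟩ := natOfString_surjective n
  rw [natString_natOfString]

theorem primrec_natOfString : Primrec natOfString :=
  Primrec.nat_sub.comp
    (Primrec.nat_add.comp primrec_binVal
      (primrec₂_pow.comp (Primrec.const 2) Primrec.list_length)) (Primrec.const 1)

/-- Inverts the primitive recursive `natOfString` by unbounded search over codes of strings. -/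
theorem computable_natString : Computable natString := by
  have hsearch : Computable₂ fun (n k : ℕ) =>
      (Encodable.decode (α := List Bool) k).bind
        (fun s => if natOfString s = n then some s else none) := by
    refine Primrec.to_comp (Primrec.option_bind (Primrec.decode.comp Primrec.snd)
      (Primrec.ite (Primrec.eq.comp (primrec_natOfString.comp Primrec.snd)
        (Primrec.fst.comp Primrec.fst)) (Primrec.option_some.comp Primrec.snd)
        (Primrec.const none)))
  refine (Partrec.rfindOpt hsearch).of_eq_tot fun n => ?_
  have hdom : (Nat.rfindOpt fun k => (Encodable.decode (α := List Bool) k).bind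
      (fun s => if natOfString s = n then some s else none)).Dom :=
    Nat.rfindOpt_dom.2 ⟨Encodable.encode (natString n), natString n, by
      simp [natOfString_natString]⟩
  obtain ⟨s, hs⟩ := Part.dom_iff_mem.1 hdom
  obtain ⟨k, hk⟩ := Nat.rfindOpt_spec hs
  obtain ⟨s', -, hs'⟩ := Option.bind_eq_some_iff.1 hk
  split_ifs at hs' with h
  obtain rfl := Option.some.inj hs'
  rwa [show natString n = s' by rw [← h, natString_natOfString]]

/-! ### Prefix complexity -/

variable {U : List Bool →. List Bool}

theorem prefixK_le {p x : List Bool} (h : x ∈ U p) : prefixK U x ≤ p.length :=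
  Nat.sInf_le ⟨p, rfl, h⟩

theorem IsPrefixComputer.map {M : List Bool →. List Bool} (hM : IsPrefixComputer M)
    {g : List Bool → List Bool} (hg : Computable g) :
    IsPrefixComputer fun p => (M p).map g where
  partrec := hM.partrec.map (hg.comp Computable.snd).to₂
  prefix_free := hM.prefix_free

namespace IsUniversalPrefixComputer

theorem exists_prefixK_le (hU : IsUniversalPrefixComputer U) {M : List Bool →. List Bool}
    (hM : IsPrefixComputer M) : ∃ c, ∀ p x, x ∈ M p → prefixK U x ≤ p.length + c := by
  obtain ⟨c, hc⟩ := hU.universal M hM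
  refine ⟨c, fun p x hx => ?_⟩
  obtain ⟨q, hq, hx⟩ := hc p x hx
  exact (prefixK_le hx).trans hq

/-- The machine defined only on the empty program, with output `x`, shows that the set in `prefixK`
is nonempty, so its infimum is attained. -/
theorem exists_program (hU : IsUniversalPrefixComputer U) (x : List Bool) :
    ∃ p, p.length = prefixK U x ∧ x ∈ U p := by
  have hM : IsPrefixComputer fun p : List Bool =>
      ((if p = [] then some x else none : Option (List Bool)) : Part (List Bool)) := by
    constructor
    · exact Computable.ofOption (Primrec.to_comp (Primrec.ite
        (Primrec.eq.comp Primrec.id (Primrec.const [])) (Primrec.const _) (Primrec.const _)))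
    · intro s t ht _ h
      simp [ht] at h
  obtain ⟨c, hc⟩ := hU.universal _ hM
  obtain ⟨q, -, hq⟩ := hc [] x (by simp)
  exact Nat.sInf_mem (s := {l | ∃ p : List Bool, p.length = l ∧ x ∈ U p}) ⟨_, q, rfl, hq⟩

theorem exists_prefixK_map_le (hU : IsUniversalPrefixComputer U)
    {g : List Bool → List Bool} (hg : Computable g) :
    ∃ c, ∀ x, prefixK U (g x) ≤ prefixK U x + c := by
  obtain ⟨c, hc⟩ := hU.exists_prefixK_le (hU.toIsPrefixComputer.map hg)
  refine ⟨c, fun x => ?_⟩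
  obtain ⟨p, hp, hx⟩ := hU.exists_program x
  rw [← hp]
  exact hc p _ (Part.mem_map g hx)

theorem exists_prefixKNat_comp_le (hU : IsUniversalPrefixComputer U) {g : ℕ → ℕ}
    (hg : Computable g) : ∃ c, ∀ n, prefixKNat U (g n) ≤ prefixKNat U n + c := by
  obtain ⟨c, hc⟩ := hU.exists_prefixK_map_le (g := fun s => natString (g (natOfString s)))
    (computable_natString.comp (hg.comp primrec_natOfString.to_comp))
  refine ⟨c, fun n => ?_⟩
  simpa [natOfString_natString, prefixKNat] using hc (natString n)

/-- Numbers at distance at most `d` have prefix complexities at bounded distance. -/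
theorem exists_prefixKNat_le_of_near (hU : IsUniversalPrefixComputer U) (d : ℕ) :
    ∃ c, ∀ a b : ℕ, a ≤ b + d → b ≤ a + d → prefixKNat U a ≤ prefixKNat U b + c := by
  -- With `e = a + d - b`, which lies in `[0, 2d]`, one has `a = b + e - d`. So finitely many
  -- computable shifts suffice, and the largest of their constants works.
  have h : ∀ e : ℕ, ∃ c, ∀ n, prefixKNat U (n + e - d) ≤ prefixKNat U n + c := fun e =>
    hU.exists_prefixKNat_comp_le (Primrec.to_comp (Primrec.nat_sub.comp
      (Primrec.nat_add.comp Primrec.id (Primrec.const e)) (Primrec.const d)))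
  choose c hc using h
  refine ⟨(Finset.range (2 * d + 1)).sup c, fun a b hab hba => ?_⟩
  have := hc (a + d - b) b
  rw [show b + (a + d - b) - d = a by omega] at this
  have hle : c (a + d - b) ≤ (Finset.range (2 * d + 1)).sup c :=
    Finset.le_sup (Finset.mem_range.2 (by omega))
  omega

end IsUniversalPrefixComputer

/-! ### Kraft's inequality and its effective converse -/

/-- A prefix-free set without the empty word is uniquely decodable, so the Kraft–McMillan inequality
applies. The empty word must be treated apart: `{[]}` is prefix-free but not uniquely decodable. -/
theorem IsPrefixComputer.kraft {M : List Bool →. List Bool} (hM : IsPrefixComputer M)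
    (F : Finset (List Bool)) (hF : ∀ p ∈ F, (M p).Dom) :
    ∑ p ∈ F, (1 / 2 : ℝ) ^ p.length ≤ 1 := by
  by_cases hnil : [] ∈ F
  · have : F = {[]} := by
      refine Finset.eq_singleton_iff_unique_mem.2 ⟨hnil, fun p hp => ?_⟩
      by_contra hne
      exact hM.prefix_free [] p hne (hF _ hnil) (hF p hp)
    simp [this]
  have hprefix : ∀ p ∈ F, ∀ q ∈ F, p <+: q → p = q := by
    rintro p hp q hq ⟨u, rfl⟩
    by_contra hne
    exact hM.prefix_free p u (by rintro rfl; simp at hne) (hF _ hp) (hF _ hq)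
  have hud : InformationTheory.UniquelyDecodable (F : Set (List Bool)) := by
    intro L₁
    induction L₁ with
    | nil =>
      rintro (_ | ⟨q, L₂⟩) - h₂ h
      · rfl
      · obtain ⟨rfl, -⟩ := List.append_eq_nil_iff.1 (show q ++ L₂.flatten = [] from h.symm)
        exact absurd (h₂ _ List.mem_cons_self) hnil
    | cons p L₁ ih =>
      rintro (_ | ⟨q, L₂⟩) h₁ h₂ h
      · obtain ⟨rfl, -⟩ := List.append_eq_nil_iff.1 (show p ++ L₁.flatten = [] from h)
        exact absurd (h₁ _ List.mem_cons_self) hnil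
      · have hp := h₁ p List.mem_cons_self
        have hq := h₂ q List.mem_cons_self
        have h' : p ++ L₁.flatten = q ++ L₂.flatten := h
        have hpq : p = q := by
          rcases List.prefix_or_prefix_of_prefix (List.prefix_append p L₁.flatten)
            (h' ▸ List.prefix_append q L₂.flatten) with hpre | hpre
          · exact hprefix p hp q hq hpre
          · exact (hprefix q hq p hp hpre).symm
        subst hpq
        rw [ih L₂ (fun w hw => h₁ w (List.mem_cons_of_mem _ hw))
          (fun w hw => h₂ w (List.mem_cons_of_mem _ hw)) (List.append_cancel_left h')]
  simpa using InformationTheory.kraft_mcmillan_inequality hud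

/-- The weight `2 ^ (-L)` of an optional request `(y, L)` for a program of length about `L`. -/
noncomputable def reqWeight (o : Option (List Bool × ℕ)) : ℝ :=
  o.elim 0 fun a => (1 / 2 : ℝ) ^ a.2

theorem reqWeight_nonneg (o : Option (List Bool × ℕ)) : 0 ≤ reqWeight o := by
  cases o <;> simp [reqWeight]

/-- The sum of the weights of the first `t` requests, multiplied by `2 ^ t`. -/
def scaledWeight (g : ℕ → Option (List Bool × ℕ)) (t : ℕ) : ℕ :=
  t.rec 0 fun t A => 2 * A + (g t).elim 0 fun a => 2 ^ (t + 1 - a.2)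

theorem scaledWeight_succ (g : ℕ → Option (List Bool × ℕ)) (t : ℕ) :
    scaledWeight g (t + 1) =
      2 * scaledWeight g t + (g t).elim 0 fun a => 2 ^ (t + 1 - a.2) := rfl

/-- The bound `L ≤ t` keeps the truncated exponent `t + 1 - L` exact, so the left ends of the
reserved intervals are computed in integers without rounding. -/
theorem scaledWeight_eq {g : ℕ → Option (List Bool × ℕ)}
    (hL : ∀ t y L, g t = some (y, L) → L ≤ t) (t : ℕ) :
    (scaledWeight g t : ℝ) = 2 ^ t * ∑ i ∈ Finset.range t, reqWeight (g i) := by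
  induction t with
  | zero => simp [scaledWeight]
  | succ t ih =>
    rw [scaledWeight_succ, Finset.sum_range_succ, mul_add, Nat.cast_add, Nat.cast_mul, ih]
    congr 1
    · push_cast; ring
    · rcases h : g t with _ | ⟨y, L⟩
      · simp [reqWeight]
      · have := hL t y L h
        simp only [Option.elim_some, reqWeight, one_div, inv_pow]
        rw [eq_mul_inv_iff_mul_eq₀ (by positivity)]
        push_cast
        rw [← pow_add, Nat.sub_add_cancel (by omega)]

theorem primrec_scaledWeight {g : ℕ → Option (List Bool × ℕ)} (hg : Primrec g) :
    Primrec (scaledWeight g) := by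
  refine Primrec.nat_rec₁ 0 (Primrec₂.mk ?_)
  have h : Primrec fun x : ℕ × ℕ => (g x.1).elim 0 fun a => 2 ^ (x.1 + 1 - a.2) := by
    refine (Primrec.option_casesOn (hg.comp Primrec.fst) (Primrec.const 0)
      (Primrec₂.mk (f := fun (x : ℕ × ℕ) (a : List Bool × ℕ) => 2 ^ (x.1 + 1 - a.2))
        (primrec₂_pow.comp (Primrec.const 2) (Primrec.nat_sub.comp
          (Primrec.succ.comp (Primrec.fst.comp Primrec.fst))
          (Primrec.snd.comp Primrec.snd))))).of_eq fun x => ?_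
    cases g x.1 <;> rfl
  exact Primrec.nat_add.comp (Primrec.nat_mul.comp (Primrec.const 2) Primrec.snd) h

/-- The program `q` serves request number `t`: the dyadic interval of `q` has half the length
of the interval reserved for the request, and its left end lies in the left half. -/
def Serves (g : ℕ → Option (List Bool × ℕ)) (q : List Bool) (t L : ℕ) : Prop :=
  q.length = L + 1 ∧ scaledWeight g t * 2 ^ q.length ≤ binVal q * 2 ^ t ∧
    binVal q * 2 ^ t < scaledWeight g t * 2 ^ q.length + 2 ^ t

instance (g : ℕ → Option (List Bool × ℕ)) (q : List Bool) (t L : ℕ) :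
    Decidable (Serves g q t L) := inferInstanceAs (Decidable (_ ∧ _ ∧ _))

/-- The computer that on input `q` answers the first request served by `q`. -/
def requestComputer (g : ℕ → Option (List Bool × ℕ)) (q : List Bool) : Part (List Bool) :=
  Nat.rfindOpt fun t => (g t).bind fun a => if Serves g q t a.2 then some a.1 else none

theorem partrec_requestComputer {g : ℕ → Option (List Bool × ℕ)} (hg : Primrec g) :
    Partrec (requestComputer g) := by
  refine Partrec.rfindOpt (Primrec.to_comp (Primrec.option_bind (hg.comp Primrec.snd)
    (Primrec.ite ?_ (Primrec.option_some.comp (Primrec.fst.comp Primrec.snd))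
      (Primrec.const none))))
  have hq : Primrec fun x : (List Bool × ℕ) × List Bool × ℕ => x.1.1 :=
    Primrec.fst.comp Primrec.fst
  have ht : Primrec fun x : (List Bool × ℕ) × List Bool × ℕ => x.1.2 :=
    Primrec.snd.comp Primrec.fst
  have hlen := Primrec.list_length.comp hq
  have hA := Primrec.nat_mul.comp ((primrec_scaledWeight hg).comp ht)
    (primrec₂_pow.comp (Primrec.const 2) hlen)
  have hpow := primrec₂_pow.comp (Primrec.const 2) ht
  have hv := Primrec.nat_mul.comp (primrec_binVal.comp hq) hpow
  exact (Primrec.eq.comp hlen (Primrec.succ.comp (Primrec.snd.comp Primrec.snd))).and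
    ((Primrec.nat_le.comp hA hv).and (Primrec.nat_lt.comp hv (Primrec.nat_add.comp hA hpow)))

section Requests

variable {g : ℕ → Option (List Bool × ℕ)} (hL : ∀ t y L, g t = some (y, L) → L ≤ t)
include hL

/-- The dyadic interval of `q` lies inside the interval reserved for request `t`, whose ends are
consecutive partial sums of the weights. -/
theorem Serves.bounds {q y : List Bool} {t L : ℕ} (h : Serves g q t L) (hg : g t = some (y, L)) :
    ∑ i ∈ Finset.range t, reqWeight (g i) ≤ binVal q / 2 ^ q.length ∧
      ((binVal q : ℝ) + 1) / 2 ^ q.length ≤ ∑ i ∈ Finset.range (t + 1), reqWeight (g i) := by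
  obtain ⟨hlen, h₁, h₂⟩ := h
  have h₁' : (scaledWeight g t : ℝ) * 2 ^ q.length ≤ binVal q * 2 ^ t := by exact_mod_cast h₁
  have h₂' : (binVal q : ℝ) * 2 ^ t < scaledWeight g t * 2 ^ q.length + 2 ^ t := by
    exact_mod_cast h₂
  rw [scaledWeight_eq hL] at h₁' h₂'
  set S := ∑ i ∈ Finset.range t, reqWeight (g i)
  have ht : (0 : ℝ) < 2 ^ t := by positivity
  have hq : (0 : ℝ) < 2 ^ q.length := by positivity
  constructor
  · rw [le_div_iff₀ hq]
    exact le_of_mul_le_mul_left (by linarith) ht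
  · rw [Finset.sum_range_succ, hg, div_le_iff₀ hq, add_mul]
    -- The reserved interval is two dyadic intervals long; the spare one absorbs the rounding of the
    -- left end.
    have hw : reqWeight (some (y, L)) * 2 ^ q.length = 2 := by
      simp only [reqWeight, Option.elim_some, hlen, pow_succ, ← mul_assoc, ← mul_pow]
      norm_num
    rw [hw]
    have : (binVal q : ℝ) < S * 2 ^ q.length + 1 :=
      lt_of_mul_lt_mul_left (a := (2 : ℝ) ^ t) (by linarith) ht.le
    linarith

/-- The interval of `q ++ u` is contained in that of `q`, whereas intervals reserved for different
requests do not overlap. The case `u = []` says that a program serves at most one request. -/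
theorem Serves.eq_of_append {q u y y' : List Bool} {t t' L L' : ℕ} (h : Serves g q t L)
    (hg : g t = some (y, L)) (h' : Serves g (q ++ u) t' L') (hg' : g t' = some (y', L')) :
    t = t' := by
  obtain ⟨h₁, h₂⟩ := h.bounds hL hg
  obtain ⟨h₁', h₂'⟩ := h'.bounds hL hg'
  have hmono : Monotone fun t => ∑ i ∈ Finset.range t, reqWeight (g i) :=
    (Finset.sum_mono_set_of_nonneg fun i => reqWeight_nonneg _).comp Finset.range_mono
  have hu : (0 : ℝ) < 2 ^ u.length := by positivity
  have hq : (0 : ℝ) < 2 ^ q.length := by positivity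
  have hlt : (binVal u : ℝ) < 2 ^ u.length := by exact_mod_cast binVal_lt u
  rw [binVal_append, List.length_append, pow_add] at h₁' h₂'
  push_cast at h₁' h₂'
  have hlo : (binVal q : ℝ) / 2 ^ q.length <
      (binVal q * 2 ^ u.length + binVal u + 1) / (2 ^ q.length * 2 ^ u.length) := by
    rw [div_lt_div_iff₀ hq (by positivity)]
    have : (0 : ℝ) ≤ binVal u := by positivity
    nlinarith [mul_pos hq hu]
  have hhi : (binVal q * 2 ^ u.length + binVal u : ℝ) / (2 ^ q.length * 2 ^ u.length) <
      (binVal q + 1) / 2 ^ q.length := by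
    rw [div_lt_div_iff₀ (by positivity) hq]
    nlinarith [mul_pos hq hu]
  refine le_antisymm ?_ ?_
  · by_contra! hlt'
    have : ∑ i ∈ Finset.range (t' + 1), reqWeight (g i) ≤ _ := hmono (show t' + 1 ≤ t from hlt')
    exact absurd (h₂'.trans (this.trans h₁)) (not_le.2 hlo)
  · by_contra! hlt'
    have : ∑ i ∈ Finset.range (t + 1), reqWeight (g i) ≤ _ := hmono (show t + 1 ≤ t' from hlt')
    exact absurd (h₂.trans (this.trans h₁')) (not_le.2 hhi)

omit hL in
theorem exists_serves_of_mem_requestComputer {q y : List Bool} (h : y ∈ requestComputer g q) :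
    ∃ t L, g t = some (y, L) ∧ Serves g q t L := by
  obtain ⟨t, ht⟩ := Nat.rfindOpt_spec h
  obtain ⟨⟨y', L⟩, hg, hs⟩ := Option.bind_eq_some_iff.1 ht
  split_ifs at hs with hserves
  obtain rfl := Option.some.inj hs
  exact ⟨t, L, hg, hserves⟩

theorem mem_requestComputer {q y : List Bool} {t L : ℕ} (hg : g t = some (y, L))
    (hs : Serves g q t L) : y ∈ requestComputer g q := by
  have hdom : (requestComputer g q).Dom :=
    Nat.rfindOpt_dom.2 ⟨t, y, by simp [hg, hs]⟩
  obtain ⟨y', hy'⟩ := Part.dom_iff_mem.1 hdom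
  obtain ⟨t', L', hg', hs'⟩ := exists_serves_of_mem_requestComputer hy'
  obtain rfl := hs.eq_of_append hL hg (u := []) (by rwa [List.append_nil]) hg'
  rw [hg] at hg'
  obtain ⟨rfl, -⟩ := Prod.mk.inj (Option.some.inj hg')
  exact hy'

theorem isPrefixComputer_requestComputer (hg : Primrec g) :
    IsPrefixComputer (requestComputer g) where
  partrec := partrec_requestComputer hg
  prefix_free := by
    intro s u hu hs hsu
    obtain ⟨y, hy⟩ := Part.dom_iff_mem.1 hs
    obtain ⟨y', hy'⟩ := Part.dom_iff_mem.1 hsu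
    obtain ⟨t, L, hgt, hserves⟩ := exists_serves_of_mem_requestComputer hy
    obtain ⟨t', L', hgt', hserves'⟩ := exists_serves_of_mem_requestComputer hy'
    obtain rfl := hserves.eq_of_append hL hgt hserves' hgt'
    rw [hgt] at hgt'
    obtain ⟨-, rfl⟩ := Prod.mk.inj (Option.some.inj hgt')
    have h₁ := hserves.1
    have h₂ := hserves'.1
    rw [List.length_append] at h₂
    exact hu (List.length_eq_zero_iff.1 (by omega))

theorem exists_serves (hsum : ∀ T, ∑ t ∈ Finset.range T, reqWeight (g t) ≤ 1)
    {y : List Bool} {t L : ℕ} (hg : g t = some (y, L)) : ∃ q, Serves g q t L := by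
  set A := scaledWeight g t with hA
  have hceil : ∃ v, A * 2 ^ (L + 1) ≤ v * 2 ^ t ∧ v * 2 ^ t < A * 2 ^ (L + 1) + 2 ^ t := by
    have hpos := Nat.two_pow_pos t
    -- This is the ceiling of `A * 2^(L+1) / 2^t`, the first dyadic point at or after the left end
    -- of the reserved interval.
    refine ⟨(A * 2 ^ (L + 1) + (2 ^ t - 1)) / 2 ^ t, ?_⟩
    have h₁ := Nat.div_add_mod (A * 2 ^ (L + 1) + (2 ^ t - 1)) (2 ^ t)
    have h₂ := Nat.mod_lt (A * 2 ^ (L + 1) + (2 ^ t - 1)) hpos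
    rw [mul_comm] at h₁
    constructor <;> omega
  obtain ⟨v, hv₁, hv₂⟩ := hceil
  -- The reserved interval ends at or before 1, so the rounded left end still fits into `L + 1`
  -- bits.
  have hAle : A * 2 ^ (L + 1) + 2 * 2 ^ t ≤ 2 ^ (L + 1) * 2 ^ t := by
    have h := hsum (t + 1)
    have hS := scaledWeight_eq hL t
    rw [← hA] at hS
    rw [Finset.sum_range_succ, hg] at h
    set S := ∑ i ∈ Finset.range t, reqWeight (g i)
    have hw : reqWeight (some (y, L)) * 2 ^ (L + 1) = 2 := by
      simp only [reqWeight, Option.elim_some, pow_succ, ← mul_assoc, ← mul_pow]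
      norm_num
    have : (A : ℝ) * 2 ^ (L + 1) + 2 * 2 ^ t ≤ 2 ^ (L + 1) * 2 ^ t := by
      rw [hS]
      have hw' : reqWeight (some (y, L)) * 2 ^ (L + 1) * 2 ^ t = 2 * 2 ^ t := by rw [hw]
      have := mul_le_mul_of_nonneg_right h (show (0 : ℝ) ≤ 2 ^ (L + 1) * 2 ^ t by positivity)
      linarith
    exact_mod_cast this
  have hv : v < 2 ^ (L + 1) := by
    have hpos := Nat.two_pow_pos t
    exact Nat.lt_of_mul_lt_mul_right (a := 2 ^ t) (by omega)
  obtain ⟨q, hq, rfl⟩ := exists_binVal_eq hv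
  exact ⟨q, hq, by rwa [hq], by rwa [hq]⟩

end Requests

/-- Effective converse of Kraft's inequality (Kraft–Chaitin). -/
theorem IsUniversalPrefixComputer.exists_prefixK_le_of_requests {U : List Bool →. List Bool}
    (hU : IsUniversalPrefixComputer U) {g : ℕ → Option (List Bool × ℕ)} (hg : Primrec g)
    (hL : ∀ t y L, g t = some (y, L) → L ≤ t)
    (hsum : ∀ T, ∑ t ∈ Finset.range T, reqWeight (g t) ≤ 1) :
    ∃ c, ∀ t y L, g t = some (y, L) → prefixK U y ≤ L + c := by
  obtain ⟨c, hc⟩ := hU.exists_prefixK_le (isPrefixComputer_requestComputer hL hg)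
  refine ⟨c + 1, fun t y L h => ?_⟩
  obtain ⟨q, hq⟩ := exists_serves hL hsum h
  have := hc q y (mem_requestComputer hL h hq)
  rw [hq.1] at this
  omega

open Nat.Partrec (Code)
open Encodable (encode decode)

/-! ### The coding theorem -/

/-- The exponents in `S` are distinct, so the sum is at most twice its largest term. -/
theorem sum_half_pow_le {S : Finset ℕ} {P : ℝ} (hP : 0 ≤ P)
    (h : ∀ l ∈ S, 2 * (1 / 2 : ℝ) ^ l ≤ P) : ∑ l ∈ S, (1 / 2 : ℝ) ^ l ≤ P := by
  rcases S.eq_empty_or_nonempty with rfl | hne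
  · simpa using hP
  have hgeom : ∀ k : ℕ, ∑ l ∈ Finset.range k, (1 / 2 : ℝ) ^ (S.min' hne + l) ≤
      2 * (1 / 2 : ℝ) ^ S.min' hne - (1 / 2 : ℝ) ^ (S.min' hne + k) * 2 := by
    intro k
    induction k with
    | zero => simp [mul_comm]
    | succ k ih =>
      rw [Finset.sum_range_succ, ← add_assoc, pow_succ]
      linarith
  calc ∑ l ∈ S, (1 / 2 : ℝ) ^ l
      ≤ ∑ l ∈ Finset.Ico (S.min' hne) (S.max' hne + 1), (1 / 2 : ℝ) ^ l :=
        Finset.sum_le_sum_of_subset_of_nonneg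
          (fun l hl => Finset.mem_Ico.2 ⟨S.min'_le l hl, Nat.lt_succ_of_le (S.le_max' l hl)⟩)
          fun _ _ _ => by positivity
    _ ≤ 2 * (1 / 2 : ℝ) ^ S.min' hne := by
        rw [Finset.sum_Ico_eq_sum_range]
        have : (0 : ℝ) ≤ (1 / 2 : ℝ) ^ (S.min' hne + (S.max' hne + 1 - S.min' hne)) * 2 := by
          positivity
        linarith [hgeom (S.max' hne + 1 - S.min' hne)]
    _ ≤ P := h _ (S.min'_mem hne)

theorem primrec₂_sum_range {α : Type*} [Primcodable α] {f : α → ℕ → ℕ} (hf : Primrec₂ f) :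
    Primrec₂ fun a n => ∑ i ∈ Finset.range n, f a i := by
  refine (Primrec.nat_rec (f := fun _ : α => 0) (g := fun a (x : ℕ × ℕ) => x.2 + f a x.1)
    (Primrec.const 0) (Primrec.nat_add.comp (Primrec.snd.comp Primrec.snd)
      (hf.comp Primrec.fst (Primrec.fst.comp Primrec.snd)))).of_eq fun a n => ?_
  induction n with
  | zero => rfl
  | succ n ih => rw [Finset.sum_range_succ, ← ih]

/-- The programs of length at most `s` which the code `c` shows within `s` steps to produce `y`. -/
noncomputable def stageSet (c : Code) (y : List Bool) (s : ℕ) : Finset (List Bool) :=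
  ((Finset.range s).preimage encode Encodable.encode_injective.injOn).filter
    fun p => p.length ≤ s ∧ Code.evaln s c (encode p) = some (encode y)

theorem mem_stageSet {c : Code} {y p : List Bool} {s : ℕ} :
    p ∈ stageSet c y s ↔ p.length ≤ s ∧ Code.evaln s c (encode p) = some (encode y) := by
  refine ⟨fun h => (Finset.mem_filter.1 h).2, fun h => Finset.mem_filter.2 ⟨?_, h⟩⟩
  exact Finset.mem_preimage.2 (Finset.mem_range.2 (Code.evaln_bound h.2))

theorem stageSet_mono (c : Code) (y : List Bool) : Monotone (stageSet c y) := by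
  intro s s' hs p hp
  rw [mem_stageSet] at hp ⊢
  exact ⟨hp.1.trans hs, Code.evaln_mono hs hp.2⟩

/-- The part of the probability of `y` discovered by stage `s`, multiplied by `2 ^ s`. -/
noncomputable def stageSum (c : Code) (y : List Bool) (s : ℕ) : ℕ :=
  ∑ p ∈ stageSet c y s, 2 ^ (s - p.length)

theorem stageSum_eq (c : Code) (y : List Bool) (s : ℕ) :
    (stageSum c y s : ℝ) = 2 ^ s * ∑ p ∈ stageSet c y s, (1 / 2 : ℝ) ^ p.length := by
  rw [stageSum, Nat.cast_sum, Finset.mul_sum]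
  refine Finset.sum_congr rfl fun p hp => ?_
  rw [one_div, inv_pow, eq_mul_inv_iff_mul_eq₀ (by positivity)]
  push_cast
  rw [← pow_add, Nat.sub_add_cancel (mem_stageSet.1 hp).1]

theorem primrec₂_stageSum (c : Code) : Primrec₂ (stageSum c) := by
  -- The sum runs over all numbers `i < s`; the test `encode p = i` discards those that are not
  -- codes of strings.
  have hterm : Primrec₂ fun (x : List Bool × ℕ) (i : ℕ) =>
      ((decode i : Option (List Bool)).casesOn 0 fun p =>
        if encode p = i ∧ p.length ≤ x.2 ∧ Code.evaln x.2 c i = some (encode x.1)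
          then 2 ^ (x.2 - p.length) else 0 : ℕ) := by
    refine Primrec.option_casesOn (Primrec.decode.comp Primrec.snd) (Primrec.const 0)
      (Primrec.ite ?_ ?_ (Primrec.const 0))
    · have hs : Primrec fun z : ((List Bool × ℕ) × ℕ) × List Bool => z.1.1.2 :=
        Primrec.snd.comp (Primrec.fst.comp Primrec.fst)
      refine (Primrec.eq.comp (Primrec.encode.comp Primrec.snd)
        (Primrec.snd.comp Primrec.fst)).and
        ((Primrec.nat_le.comp (Primrec.list_length.comp Primrec.snd) hs).and
        (Primrec.eq.comp (Code.primrec_evaln.comp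
          ((hs.pair (Primrec.const c)).pair (Primrec.snd.comp Primrec.fst)))
          (Primrec.option_some.comp
            (Primrec.encode.comp (Primrec.fst.comp (Primrec.fst.comp Primrec.fst))))))
    · exact primrec₂_pow.comp (Primrec.const 2) (Primrec.nat_sub.comp
        (Primrec.snd.comp (Primrec.fst.comp Primrec.fst))
        (Primrec.list_length.comp Primrec.snd))
  refine ((primrec₂_sum_range hterm).comp Primrec.id Primrec.snd).of_eq fun x => ?_
  rw [stageSum, stageSet, Finset.sum_filter,
    ← Finset.sum_preimage (encode : List Bool → ℕ) (Finset.range x.2)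
    Encodable.encode_injective.injOn]
  · refine Finset.sum_congr rfl fun p _ => ?_
    simp only [Encodable.encodek, id, true_and]
  · intro i _ hi
    rcases (decode i : Option (List Bool)) with _ | p
    · rfl
    · exact if_neg fun h => hi ⟨p, h.1⟩

/-- By stage `s`, the discovered part of the probability of `y` is at least `2 ^ (-L)`. -/
def Crossed (c : Code) (y : List Bool) (L s : ℕ) : Prop := 2 ^ s ≤ stageSum c y s * 2 ^ L

noncomputable instance (c : Code) (y : List Bool) (L s : ℕ) : Decidable (Crossed c y L s) :=
  inferInstanceAs (Decidable (_ ≤ _))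

theorem crossed_iff {c : Code} {y : List Bool} {L s : ℕ} :
    Crossed c y L s ↔ (1 / 2 : ℝ) ^ L ≤ ∑ p ∈ stageSet c y s, (1 / 2 : ℝ) ^ p.length := by
  have h : Crossed c y L s ↔ (2 : ℝ) ^ s ≤ stageSum c y s * 2 ^ L := by
    unfold Crossed; exact_mod_cast Iff.rfl
  rw [h, stageSum_eq, mul_assoc, le_mul_iff_one_le_right (by positivity), one_div, inv_pow,
    inv_le_iff_one_le_mul₀ (by positivity)]

theorem Crossed.mono {c : Code} {y : List Bool} {L s s' : ℕ} (h : Crossed c y L s)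
    (hs : s ≤ s') : Crossed c y L s' := by
  rw [crossed_iff] at h ⊢
  exact h.trans (Finset.sum_le_sum_of_subset_of_nonneg (stageSet_mono c y hs)
    fun _ _ _ => by positivity)

/-- Makes the truncated `s - 1` in `codingRequest` harmless: no request is issued at stage 0. -/
theorem not_crossed_zero (c : Code) (y : List Bool) (L : ℕ) : ¬ Crossed c y L 0 := by
  simp [Crossed, stageSum, stageSet]

/-- Request number `⟨(y, L), s⟩` asks for a program of length about `L + 1` for `y` if `s` is the
first stage at which the probability of `y` is seen to be at least `2 ^ (-L)`. -/
noncomputable def codingRequest (c : Code) (t : ℕ) : Option (List Bool × ℕ) :=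
  (decode t.unpair.1 : Option (List Bool × ℕ)).bind fun a =>
    if encode a = t.unpair.1 ∧ Crossed c a.1 a.2 t.unpair.2 ∧ ¬ Crossed c a.1 a.2 (t.unpair.2 - 1)
      then some (a.1, a.2 + 1) else none

theorem primrec_codingRequest (c : Code) : Primrec (codingRequest c) := by
  have hcrossed : ∀ {f : ℕ × List Bool × ℕ → ℕ}, Primrec f →
      PrimrecPred fun x : ℕ × List Bool × ℕ => Crossed c x.2.1 x.2.2 (f x) := by
    intro f hf
    have hsum : Primrec fun x : ℕ × List Bool × ℕ => stageSum c x.2.1 (f x) :=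
      (primrec₂_stageSum c).comp (Primrec.fst.comp Primrec.snd) hf
    have hL : Primrec fun x : ℕ × List Bool × ℕ => 2 ^ x.2.2 :=
      primrec₂_pow.comp (Primrec.const 2) (Primrec.snd.comp Primrec.snd)
    exact Primrec.nat_le.comp (primrec₂_pow.comp (Primrec.const 2) hf)
      (Primrec.nat_mul.comp hsum hL)
  have hs : Primrec fun x : ℕ × List Bool × ℕ => x.1.unpair.2 :=
    Primrec.snd.comp (Primrec.unpair.comp Primrec.fst)
  have hs' : Primrec fun x : ℕ × List Bool × ℕ => x.1.unpair.2 - 1 :=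
    Primrec.nat_sub.comp hs (Primrec.const 1)
  have hdec : PrimrecPred fun x : ℕ × List Bool × ℕ => encode x.2 = x.1.unpair.1 :=
    Primrec.eq.comp (Primrec.encode.comp Primrec.snd)
      (Primrec.fst.comp (Primrec.unpair.comp Primrec.fst))
  have hout : Primrec fun x : ℕ × List Bool × ℕ => some (x.2.1, x.2.2 + 1) :=
    Primrec.option_some.comp ((Primrec.fst.comp Primrec.snd).pair
      (Primrec.succ.comp (Primrec.snd.comp Primrec.snd)))
  have hcond := hdec.and ((hcrossed hs).and (hcrossed hs').not)
  exact Primrec.option_bind (Primrec.decode.comp (Primrec.fst.comp Primrec.unpair))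
    (Primrec₂.mk (Primrec.ite hcond hout (Primrec.const none)))

theorem codingRequest_eq_some {c : Code} {t l : ℕ} {y : List Bool} :
    codingRequest c t = some (y, l) ↔ ∃ L s, l = L + 1 ∧ t = Nat.pair (encode (y, L)) s ∧
      Crossed c y L s ∧ ¬ Crossed c y L (s - 1) := by
  constructor
  · intro h
    obtain ⟨⟨y', L⟩, hdec, h⟩ := Option.bind_eq_some_iff.1 h
    split_ifs at h with hc
    obtain ⟨rfl, rfl⟩ := Prod.mk.inj (Option.some.inj h)
    exact ⟨L, t.unpair.2, rfl, by rw [hc.1, Nat.pair_unpair], hc.2⟩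
  · rintro ⟨L, s, rfl, rfl, hc⟩
    simp [codingRequest, Encodable.encodek, hc.1, hc.2]

/-- The pairing dominates `L + s` and `s ≥ 1`; this supplies the bound that exact integer
bookkeeping of requests needs. -/
theorem codingRequest_le {c : Code} {t l : ℕ} {y : List Bool}
    (h : codingRequest c t = some (y, l)) : l ≤ t := by
  obtain ⟨L, s, rfl, rfl, hc, -⟩ := codingRequest_eq_some.1 h
  have hs : s ≠ 0 := by
    rintro rfl
    exact not_crossed_zero _ _ _ hc
  have h₁ : L ≤ encode (y, L) := Nat.right_le_pair _ _
  have h₂ := Nat.add_le_pair (encode (y, L)) s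
  omega

/-- Crossing persists once it occurs, so the first crossing stage is unique and each request is made
only once. -/
theorem codingRequest_injective {c : Code} {t t' : ℕ} {a : List Bool × ℕ}
    (h : codingRequest c t = some a) (h' : codingRequest c t' = some a) : t = t' := by
  obtain ⟨y, l⟩ := a
  obtain ⟨L, s, rfl, rfl, hc, hn⟩ := codingRequest_eq_some.1 h
  obtain ⟨L', s', hl, rfl, hc', hn'⟩ := codingRequest_eq_some.1 h'
  obtain rfl : L = L' := by omega
  have key : ∀ {u v : ℕ}, Crossed c y L u → ¬ Crossed c y L (v - 1) → v ≤ u := by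
    intro u v hu hv
    by_contra! hlt
    exact hv (hu.mono (by omega))
  rw [le_antisymm (key hc' hn) (key hc hn')]

section Coding

variable {M : List Bool →. List Bool} {c : Code}

theorem mem_of_mem_stageSet (hc : ∀ p, c.eval (encode p) = (M p).map encode) {y p : List Bool}
    {s : ℕ} (h : p ∈ stageSet c y s) : y ∈ M p := by
  have := Code.evaln_sound (mem_stageSet.1 h).2
  rw [hc, Part.mem_map_iff] at this
  obtain ⟨y', hy', he⟩ := this
  rwa [← Encodable.encode_injective he]

theorem exists_mem_stageSet (hc : ∀ p, c.eval (encode p) = (M p).map encode) {y p : List Bool}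
    (h : y ∈ M p) : ∃ s, p ∈ stageSet c y s := by
  have : encode y ∈ c.eval (encode p) := by rw [hc]; exact Part.mem_map _ h
  obtain ⟨s, hs⟩ := Code.evaln_complete.1 this
  exact ⟨max s p.length, mem_stageSet.2
    ⟨le_max_right _ _, Code.evaln_mono (le_max_left _ _) hs⟩⟩

/-- Grouped by output `y`, the requests have distinct lengths and together weigh at most the part of
the probability of `y` found by stage `T`. Different outputs have disjoint program sets, so Kraft's
inequality bounds the total. -/
theorem sum_codingRequest_le (hM : IsPrefixComputer M)
    (hc : ∀ p, c.eval (encode p) = (M p).map encode) (T : ℕ) :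
    ∑ t ∈ Finset.range T, reqWeight (codingRequest c t) ≤ 1 := by
  set B := (Finset.range T).filter fun t => (codingRequest c t).isSome with hB
  set e : ℕ → List Bool × ℕ := fun t => (codingRequest c t).getD ([], 0) with he
  have hBe : ∀ t ∈ B, codingRequest c t = some (e t) := by
    intro t ht
    obtain ⟨a, ha⟩ := Option.isSome_iff_exists.1 (Finset.mem_filter.1 ht).2
    simp [he, ha]
  have hinj : Set.InjOn e B := by
    intro t ht t' ht' h
    exact codingRequest_injective (hBe t ht) (h ▸ hBe t' ht')
  have h₁ : ∑ t ∈ Finset.range T, reqWeight (codingRequest c t) =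
      ∑ a ∈ B.image e, (1 / 2 : ℝ) ^ a.2 := by
    rw [Finset.sum_image hinj, hB, Finset.sum_filter]
    refine Finset.sum_congr rfl fun t _ => ?_
    rcases h : codingRequest c t with _ | a <;> simp [reqWeight, he, h]
  set A := B.image e
  have hA : ∀ a ∈ A,
      2 * (1 / 2 : ℝ) ^ a.2 ≤ ∑ p ∈ stageSet c a.1 T, (1 / 2 : ℝ) ^ p.length := by
    intro a ha
    obtain ⟨t, ht, rfl⟩ := Finset.mem_image.1 ha
    have hreq := hBe t ht
    generalize e t = a at hreq
    obtain ⟨y, l⟩ := a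
    obtain ⟨L, s, rfl, hts, hcr, -⟩ := codingRequest_eq_some.1 hreq
    have hsT : s ≤ T := by
      have h₁ := Nat.right_le_pair (encode (y, L)) s
      have h₂ := Finset.mem_range.1 (Finset.mem_filter.1 ht).1
      omega
    rw [pow_succ]
    have := crossed_iff.1 (hcr.mono hsT)
    linarith
  have hdisj : (A.image Prod.fst : Set (List Bool)).PairwiseDisjoint fun y => stageSet c y T := by
    intro y _ y' _ hne
    refine Finset.disjoint_left.2 fun p hp hp' => hne ?_
    exact Part.mem_unique (mem_of_mem_stageSet hc hp) (mem_of_mem_stageSet hc hp')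
  calc ∑ t ∈ Finset.range T, reqWeight (codingRequest c t)
      = ∑ y ∈ A.image Prod.fst, ∑ a ∈ A with a.1 = y, (1 / 2 : ℝ) ^ a.2 := by
        rw [h₁, Finset.sum_fiberwise_of_maps_to fun a ha => Finset.mem_image_of_mem _ ha]
    _ ≤ ∑ y ∈ A.image Prod.fst, ∑ p ∈ stageSet c y T, (1 / 2 : ℝ) ^ p.length := by
        refine Finset.sum_le_sum fun y _ => ?_
        have hinj' : Set.InjOn Prod.snd (A.filter fun a => a.1 = y : Set (List Bool × ℕ)) := by
          intro a ha a' ha' h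
          have h₁ := (Finset.mem_filter.1 ha).2
          have h₂ := (Finset.mem_filter.1 ha').2
          exact Prod.ext (h₁.trans h₂.symm) h
        rw [← Finset.sum_image (f := fun l => (1 / 2 : ℝ) ^ l) hinj']
        refine sum_half_pow_le (Finset.sum_nonneg fun _ _ => by positivity) fun l hl => ?_
        obtain ⟨a, ha, rfl⟩ := Finset.mem_image.1 hl
        obtain ⟨haA, rfl⟩ := Finset.mem_filter.1 ha
        exact hA a haA
    _ = ∑ p ∈ (A.image Prod.fst).biUnion fun y => stageSet c y T, (1 / 2 : ℝ) ^ p.length :=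
        (Finset.sum_biUnion hdisj).symm
    _ ≤ 1 := hM.kraft _ fun p hp => by
        obtain ⟨y, -, hy⟩ := Finset.mem_biUnion.1 hp
        exact Part.dom_iff_mem.2 ⟨y, mem_of_mem_stageSet hc hy⟩

end Coding

theorem IsPrefixComputer.exists_code {M : List Bool →. List Bool} (hM : IsPrefixComputer M) :
    ∃ c : Code, ∀ p, c.eval (encode p) = (M p).map encode := by
  obtain ⟨c, hc⟩ := Code.exists_code.1 hM.partrec
  exact ⟨c, fun p => by rw [hc]; simp [Encodable.encodek]⟩

/-- **Coding theorem**: the probability that a prefix computer produces `y` is at most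
`2 ^ (-K(y))`, up to a constant factor. -/
theorem IsUniversalPrefixComputer.coding {U : List Bool →. List Bool}
    (hU : IsUniversalPrefixComputer U) {M : List Bool →. List Bool} (hM : IsPrefixComputer M) :
    ∃ d : ℕ, ∀ (y : List Bool) (F : Finset (List Bool)), (∀ p ∈ F, y ∈ M p) →
      (∑ p ∈ F, (1 / 2 : ℝ) ^ p.length) * 2 ^ prefixK U y ≤ 2 ^ d := by
  obtain ⟨c, hc⟩ := hM.exists_code
  obtain ⟨d, hd⟩ := hU.exists_prefixK_le_of_requests (primrec_codingRequest c)
    (fun _ _ _ => codingRequest_le) (sum_codingRequest_le hM hc)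
  refine ⟨d + 2, fun y F hF => ?_⟩
  set σ := ∑ p ∈ F, (1 / 2 : ℝ) ^ p.length with hσ
  rcases F.eq_empty_or_nonempty with rfl | ⟨p₀, hp₀⟩
  · simp only [hσ, Finset.sum_empty, zero_mul]
    positivity
  have hσ_pos : 0 < σ := Finset.sum_pos (fun _ _ => by positivity) ⟨p₀, hp₀⟩
  have hσ_le : σ ≤ 1 := hM.kraft F fun p hp => Part.dom_iff_mem.2 ⟨y, hF p hp⟩
  -- The least `L` with `2^(-L) ≤ σ` loses at most a factor 2; the request length `L + 1` loses
  -- another, whence `d + 2`.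
  obtain ⟨L, hL, hL'⟩ : ∃ L : ℕ, (1 / 2 : ℝ) ^ L ≤ σ ∧ σ ≤ 2 * (1 / 2 : ℝ) ^ L := by
    have hex : ∃ L : ℕ, (1 / 2 : ℝ) ^ L ≤ σ :=
      (exists_pow_lt_of_lt_one hσ_pos (by norm_num)).imp fun _ h => h.le
    classical
    refine ⟨Nat.find hex, Nat.find_spec hex, ?_⟩
    rcases h : Nat.find hex with _ | L
    · rw [pow_zero]; linarith
    · have := not_le.1 (Nat.find_min hex (m := L) (by omega))
      rw [pow_succ]; linarith
  have hex : ∃ s, Crossed c y L s := by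
    have : ∀ p : F, ∃ s, p.1 ∈ stageSet c y s := fun p => exists_mem_stageSet hc (hF p.1 p.2)
    choose s hs using this
    refine ⟨Finset.univ.sup s, crossed_iff.2 (hL.trans ?_)⟩
    have hsub : F ⊆ stageSet c y (Finset.univ.sup s) := fun p hp => by
      have hle : s ⟨p, hp⟩ ≤ Finset.univ.sup s := Finset.le_sup (Finset.mem_univ _)
      exact stageSet_mono c y hle (hs ⟨p, hp⟩)
    exact Finset.sum_le_sum_of_subset_of_nonneg hsub fun _ _ _ => by positivity
  have hfirst : ¬ Crossed c y L (Nat.find hex - 1) := by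
    rcases h : Nat.find hex with _ | s
    · exact not_crossed_zero c y L
    · exact Nat.find_min hex (by omega)
  have hK := hd (Nat.pair (encode (y, L)) (Nat.find hex)) y (L + 1)
    (codingRequest_eq_some.2 ⟨L, Nat.find hex, rfl, rfl, Nat.find_spec hex, hfirst⟩)
  calc σ * 2 ^ prefixK U y ≤ 2 * (1 / 2 : ℝ) ^ L * 2 ^ (L + 1 + d) := by
        gcongr
        norm_num
    _ = 2 ^ (d + 2) := by
        rw [pow_add, pow_succ, pow_add]
        have : (1 / 2 : ℝ) ^ L * 2 ^ L = 1 := by rw [← mul_pow]; norm_num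
        linear_combination (4 * 2 ^ d) * this

/-! ### Plain complexity -/

section Plain

variable {V : TwoTapeTM}

theorem plainK_le {p x : List Bool} (h : V.Computes p x) : plainK V x ≤ p.length :=
  Nat.sInf_le ⟨p, rfl, h⟩

namespace TwoTapeTM.IsReference

theorem exists_copy (hV : V.IsReference) :
    ∃ (q : List Bool) (d : ℕ), ∀ x, ∃ t ≤ x.length + d, V.HaltsWith (q ++ x) x t := by
  obtain ⟨q, d, h⟩ := hV.copies
  exact ⟨q, d, fun x => h x x x.length (copier_haltsWith x)⟩

theorem exists_program (hV : V.IsReference) (x : List Bool) :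
    ∃ p, p.length = plainK V x ∧ V.Computes p x := by
  obtain ⟨q, d, h⟩ := hV.exists_copy
  obtain ⟨t, -, ht⟩ := h x
  exact Nat.sInf_mem (s := {l | ∃ p : List Bool, p.length = l ∧ V.Computes p x})
    ⟨_, _, rfl, t, ht⟩

theorem exists_depth_le (hV : V.IsReference) :
    ∃ β γ : ℕ, ∀ m x, IsRandom V m x → depth V (m + β) x ≤ x.length + γ := by
  obtain ⟨q, d, h⟩ := hV.exists_copy
  refine ⟨q.length, d, fun m x hx => ?_⟩
  obtain ⟨t, ht, hhalt⟩ := h x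
  refine le_trans (Nat.sInf_le ?_) ht
  -- The copying program is admissible because `ℓ(x) ≤ C(x) + m`, so `β` is the length of its prefix
  -- `q`.
  refine ⟨q ++ x, ?_, hhalt⟩
  unfold IsRandom at hx
  rw [List.length_append]
  omega

theorem exists_plainK_le_length (hV : V.IsReference) :
    ∃ c : ℕ, ∀ x, plainK V x ≤ x.length + c := by
  obtain ⟨q, d, h⟩ := hV.exists_copy
  refine ⟨q.length, fun x => ?_⟩
  obtain ⟨t, -, ht⟩ := h x
  have := plainK_le ⟨t, ht⟩
  rwa [List.length_append, add_comm] at this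

end TwoTapeTM.IsReference

end Plain

/-! ### Counting -/

theorem finite_length_eq (n : ℕ) : {x : List Bool | x.length = n}.Finite :=
  List.finite_length_eq Bool n

/-- There are fewer than `2 ^ k` binary strings of length less than `k`. -/
theorem card_le_of_length_lt {F : Finset (List Bool)} {k : ℕ} (h : ∀ p ∈ F, p.length < k) :
    F.card ≤ 2 ^ k := by
  have hinj : Set.InjOn natOfString F := fun p _ q _ hpq => by
    rw [← natString_natOfString p, hpq, natString_natOfString]
  rw [← Finset.card_image_of_injOn hinj, ← Finset.card_range (2 ^ k)]
  refine Finset.card_le_card fun n hn => ?_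
  obtain ⟨p, hp, rfl⟩ := Finset.mem_image.1 hn
  have h₁ := natOfString_add_one p
  have h₂ := binVal_lt p
  have h₃ : 2 ^ (p.length + 1) ≤ 2 ^ k := Nat.pow_le_pow_right two_pos (h p hp)
  rw [pow_succ] at h₃
  rw [Finset.mem_range]
  omega

theorem card_not_isRandom_le {V : TwoTapeTM} (hV : V.IsReference) {m n : ℕ}
    {F : Finset (List Bool)} (hF : ∀ x ∈ F, x.length = n ∧ ¬ IsRandom V m x) :
    (F.card : ℝ) ≤ 2 ^ n * 2 ^ (-(m : ℤ)) := by
  rcases F.eq_empty_or_nonempty with rfl | ⟨x₀, hx₀⟩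
  · simp only [Finset.card_empty, Nat.cast_zero]
    positivity
  have hlt : ∀ x ∈ F, plainK V x + m < n := fun x hx => by
    have := hF x hx
    unfold IsRandom at this
    omega
  choose p hp hcomp using hV.exists_program
  have hinj : Set.InjOn p F := fun x _ y _ h => (hcomp x).unique (h ▸ hcomp y)
  have hcard : F.card ≤ 2 ^ (n - m) := by
    rw [← Finset.card_image_of_injOn hinj]
    refine card_le_of_length_lt fun q hq => ?_
    obtain ⟨x, hx, rfl⟩ := Finset.mem_image.1 hq
    have := hlt x hx
    rw [hp]
    omega
  -- Needed for `n - m` to be a true difference; this is why empty `F` was split off.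
  have hm : m ≤ n := by have := hlt x₀ hx₀; omega
  calc (F.card : ℝ) ≤ 2 ^ (n - m) := by exact_mod_cast hcard
    _ = 2 ^ n * 2 ^ (-(m : ℤ)) := by
      rw [zpow_neg, zpow_natCast, pow_sub₀ _ two_ne_zero hm]

theorem IsUniversalPrefixComputer.exists_card_not_isIncompressible_le {U : List Bool →. List Bool}
    (hU : IsUniversalPrefixComputer U) :
    ∃ c : ℕ, ∀ (r n : ℕ) (F : Finset (List Bool)),
      (∀ x ∈ F, x.length = n ∧ ¬ IsIncompressible U r x) →
        (F.card : ℝ) ≤ 2 ^ n * 2 ^ (-(r : ℤ) + (c : ℤ)) := by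
  -- For this machine every `U`-program of a string of length `n` is a program for `n`.
  have hM := hU.toIsPrefixComputer.map (g := fun x => natString x.length)
    (computable_natString.comp Computable.list_length)
  obtain ⟨c, hc⟩ := hU.coding hM
  refine ⟨c, fun r n F hF => ?_⟩
  choose p hp hmem using hU.exists_program
  have hinj : Set.InjOn p F := fun x _ y _ h => Part.mem_unique (hmem x) (h ▸ hmem y)
  have hcode := hc (natString n) (F.image p) fun q hq => by
    obtain ⟨x, hx, rfl⟩ := Finset.mem_image.1 hq
    rw [← (hF x hx).1]
    exact Part.mem_map (fun x : List Bool => natString x.length) (hmem x)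
  rw [Finset.sum_image hinj] at hcode
  have hterm : ∀ x ∈ F, (2 : ℝ) ^ r ≤ (1 / 2) ^ (p x).length * (2 ^ n * 2 ^ prefixKNat U n) := by
    intro x hx
    obtain ⟨hxn, hx⟩ := hF x hx
    unfold IsIncompressible at hx
    rw [one_div, inv_pow, inv_mul_eq_div, le_div_iff₀ (by positivity), ← pow_add, ← pow_add, hp]
    exact pow_le_pow_right₀ one_le_two (by rw [hxn] at hx; omega)
  have hsum := Finset.sum_le_sum hterm
  rw [Finset.sum_const, nsmul_eq_mul, ← Finset.sum_mul] at hsum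
  have hle : (F.card : ℝ) * 2 ^ r ≤ 2 ^ n * 2 ^ c := by
    refine hsum.trans ?_
    rw [mul_left_comm]
    exact mul_le_mul_of_nonneg_left hcode (by positivity)
  rw [zpow_add₀ two_ne_zero, zpow_neg, zpow_natCast, zpow_natCast, mul_left_comm,
    ← div_eq_inv_mul, le_div_iff₀ (by positivity)]
  exact hle

theorem exists_isWellBehaved {U : List Bool →. List Bool} (hU : IsUniversalPrefixComputer U)
    {V : TwoTapeTM} (hV : V.IsReference) (r m : ℕ) :
    ∃ k : ℕ, ∀ x, IsIncompressible U r x → IsRandom V m x → IsWellBehaved U V k x := by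
  obtain ⟨c, hc⟩ := hV.exists_plainK_le_length
  -- `C(x) ≤ ℓ(x) + c` by copying and `ℓ(x) ≤ C(x) + m` by randomness, so `c + m` bounds the
  -- distance both ways.
  obtain ⟨d, hd⟩ := hU.exists_prefixKNat_le_of_near (c + m)
  refine ⟨r + c + d, fun x hr hm => ?_⟩
  unfold IsIncompressible at hr
  unfold IsRandom at hm
  unfold IsWellBehaved
  have h₁ := hc x
  have h₂ := hd (plainK V x) x.length (by omega) (by omega)
  omega

end AlgInfo

theorem mainTheorem8 (U : List Bool →. List Bool) (hU : AlgInfo.IsUniversalPrefixComputer U)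
    (V : AlgInfo.TwoTapeTM) (hV : V.IsReference) :
    ∃ (c β γ : ℕ) (k : ℕ → ℕ → ℕ), ∀ r m : ℕ,
      (∀ n : ℕ,
        (2 : ℝ) ^ n * (1 - (2 : ℝ) ^ (-(r : ℤ) + (c : ℤ)) - (2 : ℝ) ^ (-(m : ℤ))) ≤
          ({x : List Bool | x.length = n ∧ AlgInfo.IsIncompressible U r x ∧
            AlgInfo.IsRandom V m x}.ncard : ℝ)) ∧
      ∀ x : List Bool, AlgInfo.IsIncompressible U r x → AlgInfo.IsRandom V m x →
        AlgInfo.depth V (m + β) x ≤ x.length + γ ∧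
        AlgInfo.IsWellBehaved U V (k r m) x := by
  obtain ⟨c, hc⟩ := hU.exists_card_not_isIncompressible_le
  obtain ⟨β, γ, hdepth⟩ := hV.exists_depth_le
  choose k hk using AlgInfo.exists_isWellBehaved hU hV
  refine ⟨c, β, γ, k, fun r m => ⟨fun n => ?_, fun x hr hm => ⟨hdepth m x hm, hk r m x hr hm⟩⟩⟩
  classical
  set S := (AlgInfo.finite_length_eq n).toFinset with hS
  have hmem : ∀ {x}, x ∈ S ↔ x.length = n := by simp [hS]
  have hcard : (S.card : ℝ) = 2 ^ n := by
    have : S = Finset.univ.map ⟨List.Vector.toList (n := n) (α := Bool), Subtype.val_injective⟩ := by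
      ext x
      rw [hmem, Finset.mem_map]
      exact ⟨fun h => ⟨⟨x, h⟩, Finset.mem_univ _, rfl⟩, by rintro ⟨v, -, rfl⟩; exact v.2⟩
    rw [this, Finset.card_map, Finset.card_univ, card_vector, Fintype.card_bool]
    norm_num
  have hgood : {x : List Bool | x.length = n ∧ AlgInfo.IsIncompressible U r x ∧
      AlgInfo.IsRandom V m x} =
        (S.filter fun x => AlgInfo.IsIncompressible U r x ∧ AlgInfo.IsRandom V m x :
          Finset (List Bool)) := by
    ext x
    simp [hmem]
  rw [hgood, Set.ncard_coe_finset]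
  have h₁ := hc r n (S.filter fun x => ¬ AlgInfo.IsIncompressible U r x) fun x hx =>
    ⟨hmem.1 (Finset.mem_filter.1 hx).1, (Finset.mem_filter.1 hx).2⟩
  have h₂ := AlgInfo.card_not_isRandom_le hV (m := m) (n := n)
    (F := S.filter fun x => ¬ AlgInfo.IsRandom V m x) fun x hx =>
    ⟨hmem.1 (Finset.mem_filter.1 hx).1, (Finset.mem_filter.1 hx).2⟩
  have h₃ : S.card ≤
      (S.filter fun x => AlgInfo.IsIncompressible U r x ∧ AlgInfo.IsRandom V m x).card +
        (S.filter fun x => ¬ AlgInfo.IsIncompressible U r x).card +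
          (S.filter fun x => ¬ AlgInfo.IsRandom V m x).card := by
    refine le_trans (Finset.card_le_card fun x hx => ?_)
      ((Finset.card_union_le _ _).trans (Nat.add_le_add_right (Finset.card_union_le _ _) _))
    simp only [Finset.mem_union, Finset.mem_filter, hx, true_and]
    tauto
  have h₃' := (Nat.cast_le (α := ℝ)).2 h₃
  push_cast at h₃'
  rw [hcard] at h₃'
  linarith
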